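/- Let $p>3$ be a prime, let $n\ge 0$ be an integer, and let $G$ be a group with triality, i.e. a group with automorphisms $\rho,\sigma$ such that $\rho^3=\sigma^2=(\rho\sigma)^2=1$ and $[x,\sigma]\,[x,\sigma]^{\rho}\,[x,\sigma]^{\rho^2}=1$ for all $x\in G$, where $[x,\sigma]=x^{-1}x^{\sigma}$. Suppose that $[g,\sigma]^{p^n}=1$ for every $g\in G$. Let $\omega$ be the ideal of the group algebra $\mathbb{F}_pG$ spanned by the elements $1-g$, $g\in G$, let $G_i=\{g\in G\mid 1-g\in\omega^i\}$ for $i\ge 1$, and let $L=L_p(G)=\bigoplus_{i\ge1}L_i$, $L_i=G_i/G_{i+1}$, be the Lie algebra over $\mathbb{F}_p$ with bracket $[xG_{i+1},yG_{j+1}]=[x,y]G_{i+j+1}$ for $x\in G_i$, $y\in G_j$, where $[x,y]=x^{-1}y^{-1}xy$; the automorphisms $\rho,\sigma$ of $G$ induce automorphisms of $L$, denoted by the same letters. Let $H=\{a\in L\mid a^\sigma=-a\}$, a Malcev algebra under $a*b=[a+2a^\rho,b]$, put $H_i=H\cap L_i$, and for $a\in H$ let $\mathrm{ad}^*(a)\colon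 H\to H$, $h\mapsto a*h$. Then: 1. $\mathrm{ad}^*(a)^{p^n}=0$ for every $i\ge1$ and every $a\in H_i$; 2. for arbitrary $a_1,\dots,a_{p^n}\in H$ (not necessarily homogeneous), $$\sum_{\pi\in S_{p^n}}\mathrm{ad}^*(a_{\pi(1)})\cdots\mathrm{ad}^*(a_{\pi(p^n)})=0 .$$ -/

import Mathlib

noncomputable section

open scoped DirectSum

namespace TrialityLie

/-! ### Groups with triality -/

/-- A triality structure on a group `G`: automorphisms `rho`, `sigma` with
`rho ^ 3 = sigma ^ 2 = (rho * sigma) ^ 2 = 1` and `u * u ^ rho * u ^ (rho ^ 2) = 1` for every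
`u = [x, sigma] = x⁻¹ * x ^ sigma`, where `x ^ φ` denotes `φ x`. -/
structure Triality (G : Type*) [Group G] where
  rho : MulAut G
  sigma : MulAut G
  rho_pow : rho ^ 3 = 1
  sigma_pow : sigma ^ 2 = 1
  rho_mul_sigma_pow : (rho * sigma) ^ 2 = 1
  triality : ∀ x : G,
    (x⁻¹ * sigma x) * rho (x⁻¹ * sigma x) * (rho ^ 2) (x⁻¹ * sigma x) = 1

variable (p : ℕ) {G : Type*} [Group G]

/-! ### The fundamental ideal and the Zassenhaus filtration -/

/-- The canonical map from `G` to the group algebra `𝔽_p G`. -/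
def gel : G →* MonoidAlgebra (ZMod p) G := MonoidAlgebra.of (ZMod p) G

variable (G) in
/-- The fundamental ideal of `𝔽_p G`: the span of the elements `1 - g`. Its `i`-th power for
`i ≥ 1` is the span of the products of `i` of its elements. -/
def omega : Submodule (ZMod p) (MonoidAlgebra (ZMod p) G) :=
  Submodule.span (ZMod p) (Set.range fun g : G => 1 - gel p g)

lemma gel_mul_mem_omega_one (g : G) {x : MonoidAlgebra (ZMod p) G} (hx : x ∈ omega p G) :
    gel p g * x ∈ omega p G := by
  unfold omega at hx ⊢
  induction hx using Submodule.span_induction with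
  | mem x h =>
    obtain ⟨h, rfl⟩ := h
    have : gel p g * (1 - gel p h) = (1 - gel p (g * h)) - (1 - gel p g) := by
      rw [map_mul]; noncomm_ring
    simp only [this]
    exact Submodule.sub_mem _ (Submodule.subset_span ⟨_, rfl⟩) (Submodule.subset_span ⟨_, rfl⟩)
  | zero => simp
  | add x y _ _ hx hy => rw [mul_add]; exact Submodule.add_mem _ hx hy
  | smul c x _ hx => rw [mul_smul_comm]; exact Submodule.smul_mem _ _ hx

lemma omega_one_mul_gel_mem (g : G) {x : MonoidAlgebra (ZMod p) G} (hx : x ∈ omega p G) :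
    x * gel p g ∈ omega p G := by
  unfold omega at hx ⊢
  induction hx using Submodule.span_induction with
  | mem x h =>
    obtain ⟨h, rfl⟩ := h
    have : (1 - gel p h) * gel p g = (1 - gel p (h * g)) - (1 - gel p g) := by
      rw [map_mul]; noncomm_ring
    simp only [this]
    exact Submodule.sub_mem _ (Submodule.subset_span ⟨_, rfl⟩) (Submodule.subset_span ⟨_, rfl⟩)
  | zero => simp
  | add x y _ _ hx hy => rw [add_mul]; exact Submodule.add_mem _ hx hy
  | smul c x _ hx => rw [smul_mul_assoc]; exact Submodule.smul_mem _ _ hx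

lemma gel_mul_mem (n : ℕ+) (g : G) {x : MonoidAlgebra (ZMod p) G}
    (hx : x ∈ omega p G ^ (n : ℕ)) : gel p g * x ∈ omega p G ^ (n : ℕ) := by
  obtain ⟨k, hk⟩ := Nat.exists_eq_succ_of_ne_zero n.ne_zero
  rw [hk, Nat.succ_eq_add_one, pow_succ'] at hx ⊢
  induction hx using Submodule.mul_induction_on' with
  | mem_mul_mem m hm n hn =>
    rw [← mul_assoc]; exact Submodule.mul_mem_mul (gel_mul_mem_omega_one p g hm) hn
  | add x _ y _ hx hy => rw [mul_add]; exact Submodule.add_mem _ hx hy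

lemma mul_gel_mem (n : ℕ+) (g : G) {x : MonoidAlgebra (ZMod p) G}
    (hx : x ∈ omega p G ^ (n : ℕ)) : x * gel p g ∈ omega p G ^ (n : ℕ) := by
  obtain ⟨k, hk⟩ := Nat.exists_eq_succ_of_ne_zero n.ne_zero
  rw [hk, Nat.succ_eq_add_one, pow_succ] at hx ⊢
  induction hx using Submodule.mul_induction_on' with
  | mem_mul_mem m hm n hn =>
    rw [mul_assoc]; exact Submodule.mul_mem_mul hm (omega_one_mul_gel_mem p g hn)
  | add x _ y _ hx hy => rw [add_mul]; exact Submodule.add_mem _ hx hy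

lemma mul_mem_omega {i j : ℕ+} {x y : MonoidAlgebra (ZMod p) G}
    (hx : x ∈ omega p G ^ (i : ℕ)) (hy : y ∈ omega p G ^ (j : ℕ)) :
    x * y ∈ omega p G ^ ((i + j : ℕ+) : ℕ) := by
  rw [PNat.add_coe, pow_add]; exact Submodule.mul_mem_mul hx hy

lemma omega_mul_omega_le : omega p G * omega p G ≤ omega p G := by
  rw [Submodule.mul_le]
  intro m hm n hn
  conv at hm => unfold omega
  induction hm using Submodule.span_induction with
  | mem x h =>
    obtain ⟨h, rfl⟩ := h
    simp only [sub_mul, one_mul]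
    exact Submodule.sub_mem _ hn (gel_mul_mem_omega_one p h hn)
  | zero => simp
  | add x y _ _ hx hy => rw [add_mul]; exact Submodule.add_mem _ hx hy
  | smul c x _ hx => rw [smul_mul_assoc]; exact Submodule.smul_mem _ _ hx

lemma omega_succ_le (i : ℕ+) : omega p G ^ ((i + 1 : ℕ+) : ℕ) ≤ omega p G ^ (i : ℕ) := by
  obtain ⟨k, hk⟩ := Nat.exists_eq_succ_of_ne_zero i.ne_zero
  rw [PNat.add_coe, PNat.one_coe, hk, Nat.succ_eq_add_one, pow_succ, pow_succ, mul_assoc]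
  exact mul_le_mul_right (omega_mul_omega_le p) _

lemma omega_anti {i j : ℕ+} (h : i ≤ j) :
    omega p G ^ (j : ℕ) ≤ omega p G ^ (i : ℕ) := by
  induction j using PNat.recOn with
  | one => rw [le_antisymm h (PNat.one_le i)]
  | succ j ih =>
    rcases h.lt_or_eq with h | rfl
    · exact (omega_succ_le p j).trans (ih (PNat.lt_add_one_iff.mp h))
    · exact le_rfl

variable (G) in
/-- The `i`-th term `G_i = {g | 1 - g ∈ ω ^ i}` of the Zassenhaus filtration, `i ≥ 1`. -/
def zas (i : ℕ+) : Subgroup G where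
  carrier := {g | 1 - gel p g ∈ omega p G ^ (i : ℕ)}
  mul_mem' {a b} ha hb := by
    have : 1 - gel p (a * b) = (1 - gel p a) + gel p a * (1 - gel p b) := by
      rw [map_mul]; noncomm_ring
    rw [Set.mem_ofPred_eq, this]
    exact Submodule.add_mem _ ha (gel_mul_mem p i a hb)
  one_mem' := by simp
  inv_mem' {a} ha := by
    have : 1 - gel p a⁻¹ = -(gel p a⁻¹ * (1 - gel p a)) := by
      rw [mul_sub, ← map_mul]; simp
    rw [Set.mem_ofPred_eq, this]
    exact Submodule.neg_mem _ (gel_mul_mem p i _ ha)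

lemma mem_zas {i : ℕ+} {g : G} : g ∈ zas p G i ↔ 1 - gel p g ∈ omega p G ^ (i : ℕ) := Iff.rfl

instance zas_normal (i : ℕ+) : (zas p G i).Normal where
  conj_mem n hn g := by
    have : 1 - gel p (g * n * g⁻¹) = gel p g * (1 - gel p n) * gel p g⁻¹ := by
      rw [mul_sub, sub_mul, mul_one, ← map_mul, ← map_mul, ← map_mul]; simp
    rw [mem_zas, this]
    exact mul_gel_mem p i _ (gel_mul_mem p i _ hn)

/-- The group commutator `[x, y] = x⁻¹ y⁻¹ x y`. -/
def comm (x y : G) : G := x⁻¹ * y⁻¹ * x * y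

lemma one_sub_comm (x y : G) : 1 - gel p (comm x y) =
    gel p (x⁻¹ * y⁻¹) *
      ((1 - gel p y) * (1 - gel p x) - (1 - gel p x) * (1 - gel p y)) := by
  have h : (1 - gel p y) * (1 - gel p x) - (1 - gel p x) * (1 - gel p y)
      = gel p (y * x) - gel p (x * y) := by
    rw [map_mul, map_mul]; noncomm_ring
  rw [h, mul_sub, ← map_mul, ← map_mul]
  simp [comm, mul_assoc]

lemma comm_mem {i j : ℕ+} {x y : G} (hx : x ∈ zas p G i) (hy : y ∈ zas p G j) :
    comm x y ∈ zas p G (i + j) := by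
  rw [mem_zas, one_sub_comm]
  refine gel_mul_mem p _ _ (Submodule.sub_mem _ ?_ (mul_mem_omega p hx hy))
  rw [add_comm]; exact mul_mem_omega p hy hx

/-- Modulo `ω ^ (i + j + 1)`, the group commutator is the ring commutator. -/
lemma comm_congr {i j : ℕ+} {x y : G} (hx : x ∈ zas p G i) (hy : y ∈ zas p G j) :
    (1 - gel p (comm x y)) -
      ((1 - gel p y) * (1 - gel p x) - (1 - gel p x) * (1 - gel p y))
      ∈ omega p G ^ ((i + j + 1 : ℕ+) : ℕ) := by
  set c := (1 - gel p y) * (1 - gel p x) - (1 - gel p x) * (1 - gel p y) with hc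
  have hcm : c ∈ omega p G ^ ((i + j : ℕ+) : ℕ) := by
    refine Submodule.sub_mem _ ?_ (mul_mem_omega p hx hy)
    rw [add_comm]; exact mul_mem_omega p hy hx
  have h1 : (1 - gel p (comm x y)) - c = -((1 - gel p (x⁻¹ * y⁻¹)) * c) := by
    rw [one_sub_comm, ← hc]; noncomm_ring
  rw [h1, add_comm (i + j) 1]
  refine Submodule.neg_mem _ (mul_mem_omega p ?_ hcm)
  rw [PNat.one_coe, pow_one]
  exact Submodule.subset_span ⟨_, rfl⟩

/-! ### The layers `G_i / G_{i+1}` -/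

variable (G) in
/-- The layer `L_i = G_i / G_{i+1}`, written additively. -/
abbrev Layer (i : ℕ+) : Type _ :=
  Additive (zas p G i ⧸ (zas p G (i + 1)).subgroupOf (zas p G i))

/-- The class `x G_{i+1}` of an element `x` of `G_i`. -/
def Layer.mk (i : ℕ+) (x : zas p G i) : Layer p G i :=
  Additive.ofMul (QuotientGroup.mk x)

lemma Layer.mk_surjective (i : ℕ+) : Function.Surjective (Layer.mk (G := G) p i) := by
  intro a
  obtain ⟨x, hx⟩ := QuotientGroup.mk_surjective (Additive.toMul a)
  exact ⟨x, by rw [Layer.mk, hx]; rfl⟩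

lemma Layer.mk_eq_iff {i : ℕ+} {x y : zas p G i} :
    Layer.mk p i x = Layer.mk p i y ↔
      gel p (x : G) - gel p (y : G) ∈ omega p G ^ ((i + 1 : ℕ+) : ℕ) := by
  have h0 : Layer.mk p i x = Layer.mk p i y ↔ (x : G)⁻¹ * (y : G) ∈ zas p G (i + 1) := by
    rw [Layer.mk, Layer.mk, Additive.ofMul.injective.eq_iff, QuotientGroup.eq,
      Subgroup.mem_subgroupOf]
    rfl
  rw [h0, mem_zas]
  have h1 : 1 - gel p ((x : G)⁻¹ * (y : G))
      = gel p (x : G)⁻¹ * (gel p (x : G) - gel p (y : G)) := by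
    rw [mul_sub, ← map_mul, ← map_mul]; simp
  have h2 : gel p (x : G) - gel p (y : G)
      = gel p (x : G) * (1 - gel p ((x : G)⁻¹ * (y : G))) := by
    rw [mul_sub, ← map_mul]; simp
  constructor
  · intro h; rw [h2]; exact gel_mul_mem p _ _ h
  · intro h; rw [h1]; exact gel_mul_mem p _ _ h

lemma Layer.mk_mul {i : ℕ+} (x y : zas p G i) :
    Layer.mk p i (x * y) = Layer.mk p i x + Layer.mk p i y := rfl

instance (i : ℕ+) : AddCommGroup (Layer p G i) :=
  { (inferInstance : AddGroup (Layer p G i)) with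
    add_comm := by
      intro a b
      obtain ⟨x, rfl⟩ := Layer.mk_surjective p i a
      obtain ⟨y, rfl⟩ := Layer.mk_surjective p i b
      change Layer.mk p i (x * y) = Layer.mk p i (y * x)
      rw [Layer.mk_eq_iff]
      have : gel p ((x * y : zas p G i) : G) - gel p ((y * x : zas p G i) : G)
          = (1 - gel p (x : G)) * (1 - gel p (y : G))
            - (1 - gel p (y : G)) * (1 - gel p (x : G)) := by
        rw [Subgroup.coe_mul, Subgroup.coe_mul, map_mul, map_mul]; noncomm_ring
      rw [this]
      have hle : i + 1 ≤ i + i := add_le_add_right (PNat.one_le i) i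
      exact Submodule.sub_mem _ (omega_anti p hle (mul_mem_omega p x.2 y.2))
        (omega_anti p hle (mul_mem_omega p y.2 x.2)) }

lemma Layer.nsmul_mk {i : ℕ+} (k : ℕ) (x : zas p G i) :
    k • Layer.mk p i x = Layer.mk p i (x ^ k) := rfl

lemma pow_congr {i : ℕ+} (x : zas p G i) (k : ℕ) :
    (gel p (x : G)) ^ k - 1 + k • (1 - gel p (x : G)) ∈ omega p G ^ ((i + 1 : ℕ+) : ℕ) := by
  induction k with
  | zero => simp
  | succ k ih =>
    have h : (gel p (x : G)) ^ (k + 1) - 1 + (k + 1) • (1 - gel p (x : G))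
        = ((gel p (x : G)) ^ k - 1 + k • (1 - gel p (x : G)))
          + (1 - gel p ((x : G) ^ k)) * (1 - gel p (x : G)) := by
      rw [map_pow, pow_succ, add_smul, one_smul]; noncomm_ring
    rw [h]
    refine Submodule.add_mem _ ih (omega_anti p (add_le_add_right (PNat.one_le i) i) ?_)
    exact mul_mem_omega p ((zas p G i).pow_mem x.2 k) x.2

/-- Each layer is an elementary abelian `p`-group, hence an `𝔽_p`-vector space. -/
instance (i : ℕ+) : Module (ZMod p) (Layer p G i) :=
  AddCommGroup.zmodModule (n := p) (by
    intro a
    obtain ⟨x, rfl⟩ := Layer.mk_surjective p i a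
    rw [Layer.nsmul_mk]
    change _ = Layer.mk p i 1
    rw [Layer.mk_eq_iff]
    have h := pow_congr p x p
    have h0 : p • (1 - gel p (x : G)) = 0 := by
      rw [← Nat.cast_smul_eq_nsmul (ZMod p), ZMod.natCast_self, zero_smul]
    rw [h0, add_zero] at h
    simpa using h)

/-! ### The Lie algebra `L_p(G)` -/

/-- A representative in `G_i` of an element of `G_i / G_{i+1}`. -/
def Layer.rep (i : ℕ+) (a : Layer p G i) : zas p G i :=
  Function.surjInv (Layer.mk_surjective p i) a

lemma Layer.mk_rep (i : ℕ+) (a : Layer p G i) : Layer.mk p i (Layer.rep p i a) = a :=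
  Function.surjInv_eq _ _

/-- The bracket `[x G_{i+1}, y G_{j+1}] = [x, y] G_{i+j+1}` as a map of sets, defined through
representatives; `layerBracketFun_mk` shows that it does not depend on their choice. -/
def layerBracketFun (i j : ℕ+) (a : Layer p G i) (b : Layer p G j) : Layer p G (i + j) :=
  Layer.mk p (i + j)
    ⟨comm (Layer.rep p i a : G) (Layer.rep p j b : G),
      comm_mem p (Layer.rep p i a).2 (Layer.rep p j b).2⟩

/-- Two commutators agree in `L_{i+j}` as soon as the ring commutators do. -/
lemma comm_sub_comm_mem {i j : ℕ+} {x x' y y' : G} (hx : x ∈ zas p G i) (hx' : x' ∈ zas p G i)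
    (hy : y ∈ zas p G j) (hy' : y' ∈ zas p G j)
    (hxx : gel p x - gel p x' ∈ omega p G ^ ((i + 1 : ℕ+) : ℕ))
    (hyy : gel p y - gel p y' ∈ omega p G ^ ((j + 1 : ℕ+) : ℕ)) :
    gel p (comm x y) - gel p (comm x' y') ∈ omega p G ^ ((i + j + 1 : ℕ+) : ℕ) := by
  have h1 := comm_congr p hx hy
  have h2 := comm_congr p hx' hy'
  have e1 : (i + j + 1 : ℕ+) = (i + 1) + j := by ring
  have e2 : (i + j + 1 : ℕ+) = i + (j + 1) := by ring
  have e3 : (i + j + 1 : ℕ+) = j + (i + 1) := by ring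
  have e4 : (i + j + 1 : ℕ+) = (j + 1) + i := by ring
  have k1 : (gel p x - gel p x') * (1 - gel p y) ∈ omega p G ^ ((i + j + 1 : ℕ+) : ℕ) := by
    rw [e1]; exact mul_mem_omega p hxx hy
  have k2 : (1 - gel p x') * (gel p y - gel p y') ∈ omega p G ^ ((i + j + 1 : ℕ+) : ℕ) := by
    rw [e2]; exact mul_mem_omega p hx' hyy
  have k3 : (1 - gel p y) * (gel p x - gel p x') ∈ omega p G ^ ((i + j + 1 : ℕ+) : ℕ) := by
    rw [e3]; exact mul_mem_omega p hy hxx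
  have k4 : (gel p y - gel p y') * (1 - gel p x') ∈ omega p G ^ ((i + j + 1 : ℕ+) : ℕ) := by
    rw [e4]; exact mul_mem_omega p hyy hx'
  have : gel p (comm x y) - gel p (comm x' y') =
      ((1 - gel p (comm x' y')) -
        ((1 - gel p y') * (1 - gel p x') - (1 - gel p x') * (1 - gel p y')))
      - ((1 - gel p (comm x y)) -
        ((1 - gel p y) * (1 - gel p x) - (1 - gel p x) * (1 - gel p y)))
      + (gel p y - gel p y') * (1 - gel p x') + (1 - gel p y) * (gel p x - gel p x')
      - (gel p x - gel p x') * (1 - gel p y) - (1 - gel p x') * (gel p y - gel p y') := by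
    noncomm_ring
  rw [this]
  exact Submodule.sub_mem _ (Submodule.sub_mem _ (Submodule.add_mem _ (Submodule.add_mem _
    (Submodule.sub_mem _ h2 h1) k4) k3) k1) k2

lemma layerBracketFun_mk (i j : ℕ+) (x : zas p G i) (y : zas p G j) :
    layerBracketFun p i j (Layer.mk p i x) (Layer.mk p j y) =
      Layer.mk p (i + j) ⟨comm (x : G) (y : G), comm_mem p x.2 y.2⟩ := by
  rw [layerBracketFun, Layer.mk_eq_iff]
  refine comm_sub_comm_mem p (Layer.rep p i _).2 x.2 (Layer.rep p j _).2 y.2 ?_ ?_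
  · rw [← Layer.mk_eq_iff]; exact Layer.mk_rep p i _
  · rw [← Layer.mk_eq_iff]; exact Layer.mk_rep p j _

lemma layerBracketFun_add_left (i j : ℕ+) (a a' : Layer p G i) (b : Layer p G j) :
    layerBracketFun p i j (a + a') b = layerBracketFun p i j a b + layerBracketFun p i j a' b := by
  obtain ⟨x, rfl⟩ := Layer.mk_surjective p i a
  obtain ⟨x', rfl⟩ := Layer.mk_surjective p i a'
  obtain ⟨y, rfl⟩ := Layer.mk_surjective p j b
  rw [← Layer.mk_mul, layerBracketFun_mk, layerBracketFun_mk, layerBracketFun_mk, ← Layer.mk_mul,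
    Layer.mk_eq_iff]
  have h1 := comm_congr p x.2 y.2
  have h2 := comm_congr p x'.2 y.2
  have h3 := comm_congr p (x * x').2 y.2
  have k : (1 - gel p (comm (x : G) y)) * (1 - gel p (comm (x' : G) y))
      ∈ omega p G ^ ((i + j + 1 : ℕ+) : ℕ) :=
    omega_anti p (add_le_add_right (PNat.one_le (i + j)) _)
      (mul_mem_omega p (comm_mem p x.2 y.2) (comm_mem p x'.2 y.2))
  have l1 : (1 - gel p (x : G)) * (1 - gel p (x' : G)) ∈ omega p G ^ ((i + 1 : ℕ+) : ℕ) :=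
    omega_anti p (add_le_add_right (PNat.one_le i) _) (mul_mem_omega p x.2 x'.2)
  have l2 : (1 - gel p (y : G)) * ((1 - gel p (x : G)) * (1 - gel p (x' : G)))
      ∈ omega p G ^ ((i + j + 1 : ℕ+) : ℕ) := by
    rw [show (i + j + 1 : ℕ+) = j + (i + 1) by ring]; exact mul_mem_omega p y.2 l1
  have l3 : ((1 - gel p (x : G)) * (1 - gel p (x' : G))) * (1 - gel p (y : G))
      ∈ omega p G ^ ((i + j + 1 : ℕ+) : ℕ) := by
    rw [show (i + j + 1 : ℕ+) = (i + 1) + j by ring]; exact mul_mem_omega p l1 y.2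
  simp only [Subgroup.coe_mul, map_mul] at h3 ⊢
  refine (Submodule.sub_mem _ (Submodule.add_mem _ (Submodule.sub_mem _ (Submodule.sub_mem _
    (Submodule.add_mem _ h1 h2) h3) k) l2) l3 : _) |> (fun h => ?_)
  convert h using 1
  noncomm_ring

lemma layerBracketFun_add_right (i j : ℕ+) (a : Layer p G i) (b b' : Layer p G j) :
    layerBracketFun p i j a (b + b') = layerBracketFun p i j a b + layerBracketFun p i j a b' := by
  obtain ⟨x, rfl⟩ := Layer.mk_surjective p i a
  obtain ⟨y, rfl⟩ := Layer.mk_surjective p j b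
  obtain ⟨y', rfl⟩ := Layer.mk_surjective p j b'
  rw [← Layer.mk_mul, layerBracketFun_mk, layerBracketFun_mk, layerBracketFun_mk, ← Layer.mk_mul,
    Layer.mk_eq_iff]
  have h1 := comm_congr p x.2 y.2
  have h2 := comm_congr p x.2 y'.2
  have h3 := comm_congr p x.2 (y * y').2
  have k : (1 - gel p (comm (x : G) y)) * (1 - gel p (comm (x : G) y'))
      ∈ omega p G ^ ((i + j + 1 : ℕ+) : ℕ) :=
    omega_anti p (add_le_add_right (PNat.one_le (i + j)) _)
      (mul_mem_omega p (comm_mem p x.2 y.2) (comm_mem p x.2 y'.2))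
  have l1 : (1 - gel p (y : G)) * (1 - gel p (y' : G)) ∈ omega p G ^ ((j + 1 : ℕ+) : ℕ) :=
    omega_anti p (add_le_add_right (PNat.one_le j) _) (mul_mem_omega p y.2 y'.2)
  have l2 : (1 - gel p (x : G)) * ((1 - gel p (y : G)) * (1 - gel p (y' : G)))
      ∈ omega p G ^ ((i + j + 1 : ℕ+) : ℕ) := by
    rw [show (i + j + 1 : ℕ+) = i + (j + 1) by ring]; exact mul_mem_omega p x.2 l1
  have l3 : ((1 - gel p (y : G)) * (1 - gel p (y' : G))) * (1 - gel p (x : G))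
      ∈ omega p G ^ ((i + j + 1 : ℕ+) : ℕ) := by
    rw [show (i + j + 1 : ℕ+) = (j + 1) + i by ring]; exact mul_mem_omega p l1 x.2
  simp only [Subgroup.coe_mul, map_mul] at h3 ⊢
  refine (Submodule.add_mem _ (Submodule.sub_mem _ (Submodule.sub_mem _ (Submodule.sub_mem _
    (Submodule.add_mem _ h1 h2) h3) k) l2) l3 : _) |> (fun h => ?_)
  convert h using 1
  noncomm_ring

/-- The bracket `[x G_{i+1}, y G_{j+1}] = [x, y] G_{i+j+1}` as a biadditive map. -/
def layerBracket (i j : ℕ+) : Layer p G i →+ Layer p G j →+ Layer p G (i + j) :=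
  AddMonoidHom.mk' (fun a => AddMonoidHom.mk' (layerBracketFun p i j a)
      (layerBracketFun_add_right p i j a))
    (fun a a' => AddMonoidHom.ext (layerBracketFun_add_left p i j a a'))

lemma layerBracket_mk (i j : ℕ+) (x : zas p G i) (y : zas p G j) :
    layerBracket p i j (Layer.mk p i x) (Layer.mk p j y) =
      Layer.mk p (i + j) ⟨comm (x : G) (y : G), comm_mem p x.2 y.2⟩ :=
  layerBracketFun_mk p i j x y

variable (G) in
/-- The space `L_p(G) = ⨁_{i ≥ 1} G_i / G_{i+1}`. -/
abbrev ZLie : Type _ := ⨁ i : ℕ+, Layer p G i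

/-- The homogeneous element of `L_p(G)` of degree `i` given by `x ∈ G_i`. -/
def cls (i : ℕ+) (x : G) (hx : x ∈ zas p G i) : ZLie p G :=
  DirectSum.of (Layer p G) i (Layer.mk p i ⟨x, hx⟩)

/-- The bracket of `L_p(G)`, the biadditive extension of the brackets of the layers. -/
def bracketHom : ZLie p G →+ ZLie p G →+ ZLie p G :=
  DirectSum.toAddMonoid fun i =>
    AddMonoidHom.flip <|
      DirectSum.toAddMonoid fun j =>
        AddMonoidHom.flip <| (DirectSum.of (Layer p G) (i + j)).compHom.comp <| layerBracket p i j

lemma bracketHom_cls (i j : ℕ+) {x y : G} (hx : x ∈ zas p G i) (hy : y ∈ zas p G j) :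
    bracketHom p (cls p i x hx) (cls p j y hy) = cls p (i + j) (comm x y) (comm_mem p hx hy) := by
  simp [bracketHom, cls, layerBracket_mk]

lemma cls_eq {i j : ℕ+} (hij : i = j) {x y : G} (hx : x ∈ zas p G i) (hy : y ∈ zas p G j)
    (h : gel p x - gel p y ∈ omega p G ^ ((i + 1 : ℕ+) : ℕ)) : cls p i x hx = cls p j y hy := by
  subst hij
  exact congrArg (DirectSum.of (Layer p G) i) ((Layer.mk_eq_iff p (x := ⟨x, hx⟩) (y := ⟨y, hy⟩)).mpr h)

lemma cls_add {i : ℕ+} {x y : G} (hx : x ∈ zas p G i) (hy : y ∈ zas p G i) :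
    cls p i x hx + cls p i y hy = cls p i (x * y) (mul_mem hx hy) := by
  rw [cls, cls, ← map_add, ← Layer.mk_mul]; rfl

lemma cls_one (i : ℕ+) : cls p i (1 : G) (one_mem _) = 0 := by
  rw [cls, ← map_zero (DirectSum.of (Layer p G) i)]; rfl

lemma cls_induction {P : ZLie p G → Prop} (h0 : P 0)
    (hc : ∀ i x hx, P (cls p i x hx)) (ha : ∀ x y, P x → P y → P (x + y)) (x : ZLie p G) : P x := by
  induction x using DirectSum.induction_on with
  | zero => exact h0
  | of i x =>
    obtain ⟨x, rfl⟩ := Layer.mk_surjective p i x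
    exact hc i x x.2
  | add x y hx hy => exact ha x y hx hy

lemma bracketHom_skew (x y : ZLie p G) : bracketHom p x y + bracketHom p y x = 0 := by
  induction x using cls_induction with
  | h0 => simp
  | ha x x' hx hx' =>
    simp only [map_add, AddMonoidHom.add_apply]
    rw [add_add_add_comm, hx, hx', add_zero]
  | hc i x hx =>
    induction y using cls_induction with
    | h0 => simp
    | ha y y' hy hy' =>
      simp only [map_add, AddMonoidHom.add_apply]
      rw [add_add_add_comm, hy, hy', add_zero]
    | hc j y hy =>
      rw [bracketHom_cls, bracketHom_cls]
      have e : cls p (j + i) (comm y x) (comm_mem p hy hx)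
          = cls p (i + j) (comm y x) (add_comm j i ▸ comm_mem p hy hx) :=
        cls_eq p (add_comm j i) _ _ (by simp)
      have e' : comm x y * comm y x = 1 := by simp [comm, mul_assoc]
      rw [e, cls_add]
      simp only [e', cls_one]

lemma bracketHom_self (x : ZLie p G) : bracketHom p x x = 0 := by
  induction x using cls_induction with
  | h0 => simp
  | ha x x' hx hx' =>
    simp only [map_add, AddMonoidHom.add_apply]
    rw [hx, hx', zero_add, add_zero, add_comm, bracketHom_skew]
  | hc i x hx =>
    rw [bracketHom_cls]
    have e' : comm x x = 1 := by simp [comm, mul_assoc]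
    simp only [e', cls_one]

/-- Double commutators modulo `ω ^ (i + j + k + 1)`. -/
lemma comm_comm_congr {i j k : ℕ+} {x y z : G} (hx : x ∈ zas p G i) (hy : y ∈ zas p G j)
    (hz : z ∈ zas p G k) :
    (1 - gel p (comm x (comm y z))) -
      (((1 - gel p z) * (1 - gel p y) - (1 - gel p y) * (1 - gel p z)) * (1 - gel p x)
        - (1 - gel p x) * ((1 - gel p z) * (1 - gel p y) - (1 - gel p y) * (1 - gel p z)))
      ∈ omega p G ^ ((i + j + k + 1 : ℕ+) : ℕ) := by
  have h1 := comm_congr p hy hz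
  have h2 := comm_congr p hx (comm_mem p hy hz)
  rw [show i + (j + k) + 1 = i + j + k + 1 by ring] at h2
  set c := (1 - gel p z) * (1 - gel p y) - (1 - gel p y) * (1 - gel p z)
  set d := 1 - gel p (comm y z)
  have h3 : (d - c) * (1 - gel p x) ∈ omega p G ^ ((i + j + k + 1 : ℕ+) : ℕ) := by
    rw [show i + j + k + 1 = (j + k + 1) + i by ring]; exact mul_mem_omega p h1 hx
  have h4 : (1 - gel p x) * (d - c) ∈ omega p G ^ ((i + j + k + 1 : ℕ+) : ℕ) := by
    rw [show i + j + k + 1 = i + (j + k + 1) by ring]; exact mul_mem_omega p hx h1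
  convert Submodule.sub_mem _ (Submodule.add_mem _ h2 h3) h4 using 1
  noncomm_ring

lemma bracketHom_jacobi (x y z : ZLie p G) :
    bracketHom p x (bracketHom p y z) + bracketHom p y (bracketHom p z x)
      + bracketHom p z (bracketHom p x y) = 0 := by
  induction x using cls_induction with
  | h0 => simp
  | ha x x' hx hx' =>
    simp only [map_add, AddMonoidHom.add_apply]
    rw [← add_zero (0 : ZLie p G)]
    nth_rewrite 1 [← hx]; rw [← hx']; abel
  | hc i x hx =>
  induction y using cls_induction with
  | h0 => simp
  | ha y y' hy hy' =>
    simp only [map_add, AddMonoidHom.add_apply]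
    rw [← add_zero (0 : ZLie p G)]
    nth_rewrite 1 [← hy]; rw [← hy']; abel
  | hc j y hy =>
  induction z using cls_induction with
  | h0 => simp
  | ha z z' hz hz' =>
    simp only [map_add, AddMonoidHom.add_apply]
    rw [← add_zero (0 : ZLie p G)]
    nth_rewrite 1 [← hz]; rw [← hz']; abel
  | hc k z hz =>
  have m1 : comm x (comm y z) ∈ zas p G (i + j + k) := by
    rw [add_assoc]; exact comm_mem p hx (comm_mem p hy hz)
  have m2 : comm y (comm z x) ∈ zas p G (i + j + k) := by
    rw [show i + j + k = j + (k + i) by ring]; exact comm_mem p hy (comm_mem p hz hx)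
  have m3 : comm z (comm x y) ∈ zas p G (i + j + k) := by
    rw [show i + j + k = k + (i + j) by ring]; exact comm_mem p hz (comm_mem p hx hy)
  have e1 : bracketHom p (cls p i x hx) (bracketHom p (cls p j y hy) (cls p k z hz))
      = cls p (i + j + k) (comm x (comm y z)) m1 := by
    rw [bracketHom_cls, bracketHom_cls]
    exact cls_eq p (by ring) _ _ (by simp)
  have e2 : bracketHom p (cls p j y hy) (bracketHom p (cls p k z hz) (cls p i x hx))
      = cls p (i + j + k) (comm y (comm z x)) m2 := by
    rw [bracketHom_cls, bracketHom_cls]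
    exact cls_eq p (by ring) _ _ (by simp)
  have e3 : bracketHom p (cls p k z hz) (bracketHom p (cls p i x hx) (cls p j y hy))
      = cls p (i + j + k) (comm z (comm x y)) m3 := by
    rw [bracketHom_cls, bracketHom_cls]
    exact cls_eq p (by ring) _ _ (by simp)
  rw [e1, e2, e3, cls_add, cls_add, ← cls_one p (i + j + k)]
  refine cls_eq p rfl _ _ ?_
  have c1 := comm_comm_congr p hx hy hz
  have c2 := comm_comm_congr p hy hz hx
  rw [show j + k + i + 1 = i + j + k + 1 by ring] at c2
  have c3 := comm_comm_congr p hz hx hy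
  rw [show k + i + j + 1 = i + j + k + 1 by ring] at c3
  have hle : i + j + k + 1 ≤ (i + j + k) + (i + j + k) := add_le_add_right (PNat.one_le _) _
  have n1 := omega_anti p hle (mul_mem_omega p m1 m2)
  have n2 := omega_anti p hle (mul_mem_omega p ((zas p G (i + j + k)).mul_mem m1 m2) m3)
  simp only [map_mul, map_one] at n2 ⊢
  convert Submodule.add_mem _ (Submodule.add_mem _ (Submodule.neg_mem _ (Submodule.add_mem _
    (Submodule.add_mem _ c1 c2) c3)) n1) n2 using 1
  noncomm_ring

/-- `L_p(G)` is a Lie ring under `[x G_{i+1}, y G_{j+1}] = [x, y] G_{i+j+1}`. -/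
instance : LieRing (ZLie p G) where
  bracket x y := bracketHom p x y
  add_lie x y z := by simp only [map_add, AddMonoidHom.add_apply]
  lie_add x y z := by simp only [map_add]
  lie_self x := bracketHom_self p x
  leibniz_lie x y z := by
    have h := bracketHom_jacobi p x y z
    have h1 : bracketHom p z x = - bracketHom p x z :=
      eq_neg_of_add_eq_zero_left (bracketHom_skew p z x)
    have h2 : bracketHom p z (bracketHom p x y) = - bracketHom p (bracketHom p x y) z :=
      eq_neg_of_add_eq_zero_left (bracketHom_skew p _ _)
    rw [h1, h2, map_neg] at h
    rw [← sub_eq_zero, ← h]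
    abel

lemma lie_cls (i j : ℕ+) {x y : G} (hx : x ∈ zas p G i) (hy : y ∈ zas p G j) :
    ⁅cls p i x hx, cls p j y hy⁆ = cls p (i + j) (comm x y) (comm_mem p hx hy) :=
  bracketHom_cls p i j hx hy

/-- `L_p(G)` is a Lie algebra over `𝔽_p`. -/
instance : LieAlgebra (ZMod p) (ZLie p G) where
  lie_smul c x y := map_smul ((bracketHom p x).toZModLinearMap p) c y

/-! ### The induced automorphisms -/

lemma map_mem_zas (φ : MulAut G) {i : ℕ+} {g : G} (hg : g ∈ zas p G i) : φ g ∈ zas p G i := by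
  let F : MonoidAlgebra (ZMod p) G →ₐ[ZMod p] MonoidAlgebra (ZMod p) G :=
    MonoidAlgebra.lift (ZMod p) _ G ((gel p).comp φ.toMonoidHom)
  have hF : ∀ h : G, F (gel p h) = gel p (φ h) := fun h => by
    simp [F, gel]
  have h1 : (omega p G).map F.toLinearMap ≤ omega p G := by
    rw [omega, Submodule.map_span, Submodule.span_le]
    rintro _ ⟨_, ⟨h, rfl⟩, rfl⟩
    refine Submodule.subset_span ⟨φ h, ?_⟩
    simp only [AlgHom.toLinearMap_apply, map_sub, map_one, hF]
  have h2 : (omega p G ^ (i : ℕ)).map F.toLinearMap ≤ omega p G ^ (i : ℕ) := by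
    rw [Submodule.map_pow]
    exact pow_le_pow_left' h1 _
  have h3 := h2 (Submodule.mem_map_of_mem hg)
  simp only [AlgHom.toLinearMap_apply, map_sub, map_one, hF] at h3
  exact h3

/-- The map `g G_{i+1} ↦ g ^ φ G_{i+1}` on a layer. -/
def layerMap (φ : MulAut G) (i : ℕ+) : Layer p G i →+ Layer p G i :=
  MonoidHom.toAdditive <|
    QuotientGroup.map _ _
      ((φ.toMonoidHom.comp (zas p G i).subtype).codRestrict (zas p G i)
        fun g => map_mem_zas p φ g.2)
      (fun g hg => by
        rw [Subgroup.mem_comap, Subgroup.mem_subgroupOf]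
        exact map_mem_zas p φ (Subgroup.mem_subgroupOf.mp hg))

lemma layerMap_mk (φ : MulAut G) (i : ℕ+) (x : zas p G i) :
    layerMap p φ i (Layer.mk p i x) = Layer.mk p i ⟨φ x, map_mem_zas p φ x.2⟩ := rfl

/-- The additive endomorphism of `L_p(G)` induced by an automorphism of `G`. -/
def actHom (φ : MulAut G) : ZLie p G →+ ZLie p G :=
  DirectSum.toAddMonoid fun i => (DirectSum.of (Layer p G) i).comp (layerMap p φ i)

lemma actHom_cls (φ : MulAut G) (i : ℕ+) {x : G} (hx : x ∈ zas p G i) :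
    actHom p φ (cls p i x hx) = cls p i (φ x) (map_mem_zas p φ hx) := by
  simp [actHom, cls, layerMap_mk]

/-- The Lie algebra endomorphism `g G_{i+1} ↦ g ^ φ G_{i+1}` of `L_p(G)` induced by an
automorphism `φ` of `G`. -/
def act (φ : MulAut G) : ZLie p G →ₗ⁅ZMod p⁆ ZLie p G :=
  { (actHom p φ).toZModLinearMap p with
    map_lie' := by
      intro x y
      change actHom p φ ⁅x, y⁆ = ⁅actHom p φ x, actHom p φ y⁆
      induction x using cls_induction with
      | h0 => simp
      | ha x x' hx hx' => simp only [map_add, add_lie, hx, hx']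
      | hc i x hx =>
      induction y using cls_induction with
      | h0 => simp
      | ha y y' hy hy' => simp only [map_add, lie_add, hy, hy']
      | hc j y hy =>
        rw [actHom_cls, actHom_cls, lie_cls, lie_cls, actHom_cls]
        exact cls_eq p rfl _ _ (by simp [comm]) }

lemma act_cls (φ : MulAut G) (i : ℕ+) {x : G} (hx : x ∈ zas p G i) :
    act p φ (cls p i x hx) = cls p i (φ x) (map_mem_zas p φ hx) :=
  actHom_cls p φ i hx

lemma act_mul (φ ψ : MulAut G) (x : ZLie p G) : act p (φ * ψ) x = act p φ (act p ψ x) := by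
  induction x using cls_induction with
  | h0 => simp
  | ha x y hx hy => simp only [map_add, hx, hy]
  | hc i x hx => rw [act_cls, act_cls, act_cls]; rfl

/-- The identity making `L_p(G)` a Lie algebra with triality. -/
lemma act_triality (T : Triality G) (x : ZLie p G) :
    (act p T.sigma x - x) + act p T.rho (act p T.sigma x - x)
      + act p T.rho (act p T.rho (act p T.sigma x - x)) = 0 := by
  induction x using cls_induction with
  | h0 => simp
  | ha x y hx hy =>
    rw [← add_zero (0 : ZLie p G)]
    nth_rewrite 1 [← hx]; rw [← hy]
    simp only [map_add, map_sub]
    abel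
  | hc i x hx =>
    have e : act p T.sigma (cls p i x hx) - cls p i x hx
        = cls p i (x⁻¹ * T.sigma x) (mul_mem (inv_mem hx) (map_mem_zas p _ hx)) := by
      rw [sub_eq_iff_eq_add', act_cls, cls_add]
      exact cls_eq p rfl _ _ (by simp)
    rw [e, act_cls, act_cls, cls_add, cls_add, ← cls_one p i]
    refine cls_eq p rfl _ _ ?_
    have h := T.triality x
    rw [pow_two, MulAut.mul_apply] at h
    rw [h]; simp

/-! ### The Malcev algebra `H` -/

/-- The subspace `H = {x ∈ L_p(G) | x ^ sigma = -x}`. -/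
def malcev (T : Triality G) : Submodule (ZMod p) (ZLie p G) where
  carrier := {x | act p T.sigma x = -x}
  add_mem' {x y} hx hy := by
    rw [Set.mem_ofPred_eq] at *
    rw [map_add, hx, hy, neg_add]
  zero_mem' := by simp
  smul_mem' c x hx := by
    rw [Set.mem_ofPred_eq] at *
    rw [map_smul, hx, smul_neg]

/-- The product `a * b = [a ^ alpha, b] = [a + 2 a ^ rho, b]`, on all of `L_p(G)`. -/
def starMul (T : Triality G) (a b : ZLie p G) : ZLie p G := ⁅a + (2 : ZMod p) • act p T.rho a, b⁆

lemma sum_rho_eq_zero (T : Triality G) [Fact p.Prime] (hp : 3 < p) {a : ZLie p G}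
    (ha : a ∈ malcev p T) : a + act p T.rho a + act p T.rho (act p T.rho a) = 0 := by
  have h := act_triality p T a
  rw [show act p T.sigma a = -a from ha] at h
  have h2 : (-2 : ZMod p) • (a + act p T.rho a + act p T.rho (act p T.rho a)) = 0 := by
    rw [← h]
    simp only [map_sub, map_neg]
    module
  have hne : (-2 : ZMod p) ≠ 0 := by
    rw [neg_ne_zero]
    intro h0
    have : ((2 : ℕ) : ZMod p) = 0 := by exact_mod_cast h0
    rw [ZMod.natCast_eq_zero_iff] at this
    exact absurd (Nat.le_of_dvd (by norm_num) this) (by omega)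
  exact (smul_eq_zero.mp h2).resolve_left hne

lemma dihedral_rel {K : Type*} [Group K] {r s : K} (h3 : r ^ 3 = 1) (h2 : s ^ 2 = 1)
    (h1 : (r * s) ^ 2 = 1) : s * r = r * r * s := by
  have h4 : s * r = r⁻¹ * (r * s) ^ 2 * s⁻¹ := by rw [pow_two]; group
  have h5 : r⁻¹ = r * r := by
    rw [inv_eq_iff_mul_eq_one, ← h3, pow_three]
  have h6 : s⁻¹ = s := by
    rw [inv_eq_iff_mul_eq_one, ← h2, pow_two]
  rw [h4, h1, h5, h6, mul_one]

/-- `H` is closed under the product `*`. -/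
lemma starMul_mem (T : Triality G) [Fact p.Prime] (hp : 3 < p) {a b : ZLie p G}
    (ha : a ∈ malcev p T) (hb : b ∈ malcev p T) : starMul p T a b ∈ malcev p T := by
  have hs := sum_rho_eq_zero p T hp ha
  have hg : T.sigma * T.rho = T.rho * T.rho * T.sigma :=
    dihedral_rel T.rho_pow T.sigma_pow T.rho_mul_sigma_pow
  have h7 : act p T.sigma (act p T.rho a) = -act p T.rho (act p T.rho a) := by
    rw [← act_mul, hg, act_mul, act_mul, show act p T.sigma a = -a from ha, map_neg, map_neg]
  have h8 : act p T.rho (act p T.rho a) = -(a + act p T.rho a) :=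
    eq_neg_of_add_eq_zero_right hs
  have h9 : act p T.sigma (a + (2 : ZMod p) • act p T.rho a)
      = a + (2 : ZMod p) • act p T.rho a := by
    rw [map_add, map_smul, h7, h8, show act p T.sigma a = -a from ha]
    module
  change act p T.sigma _ = - _
  rw [starMul, LieHom.map_lie, h9, show act p T.sigma b = -b from hb, lie_neg]

/-- The operator `ad*(a) : h ↦ a * h` of multiplication by `a` in the algebra `H`. -/
def adStar (T : Triality G) [Fact p.Prime] (hp : 3 < p) (a : malcev p T) :
    Module.End (ZMod p) (malcev p T) where
  toFun h := ⟨starMul p T a h, starMul_mem p T hp a.2 h.2⟩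
  map_add' _ _ := Subtype.ext (lie_add _ _ _)
  map_smul' c _ := Subtype.ext (lie_smul c _ _)

/-- The homogeneous component `H_i = H ∩ L_i`, as a subspace of `H`. -/
def malcevComponent (T : Triality G) (i : ℕ+) : Submodule (ZMod p) (malcev p T) :=
  (LinearMap.range (DirectSum.lof (ZMod p) ℕ+ (Layer p G) i)).comap (malcev p T).subtype

end TrialityLie

end

/-! For `a` in `H` the operator ad*(a) is the restriction to `H` of ad(a + 2a^ρ), so both claims
follow from identities between adjoint operators on `L`. Since a^σ = -a and 2 is invertible, a +
2a^ρ is the image of -a/2 under x ↦ (x^σ - x) + 2(x^σ - x)^ρ. On homogeneous classes this map comes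
from the group word w(x) = u(u^ρ)^2 with u = [x,σ] (`wordMap_cls`). Triality makes u and u^ρ commute
(`Triality.commute_rho`), so w(x)^(p^n) = 1 for every x in `G`.

An element v with v^(p^n) = 1 satisfies (v - 1)^(p^n) = v^(p^n) - 1 = 0 in the group algebra, and
there ad(y)^(p^n) = ad(y^(p^n)) in characteristic p. Hence ad(v - 1)^(p^n) = 0. The relation
`IsSymbol` passes to `L`: the bracket of classes is the leading term of the ring commutator, and a
class whose leading term vanishes is zero. This gives the first claim.

The second claim also concerns sums of elements of different degrees, so it is obtained by
linearizing inside the group. For g_k in G_{d_k} and q = p^n, let g_S be the product of the g_k with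
k in S. Then w(g_S) is a sum over T ⊆ S of terms of degree at least the weight of T, and ad(w(g_S) -
1)^q = 0 for every S. Inclusion-exclusion isolates the q-tuples of subsets that cover all indices.
The tuples of singletons given by permutations form the symmetrized product, and every other nonzero
contribution has strictly larger degree (`sum_perm_prod_mem`). So the symmetrized product vanishes
on classes, and multilinearity extends this to all of `L`. -/

noncomputable section

open scoped DirectSum

namespace TrialityLie

/-! ### Linearization of nil identities in filtered rings -/

section Linearization

variable {B : Type*} [Ring B]

/-- If the sets `T j` cover `Fin q` and are nonempty, but are not the singletons `{π j}` of a
permutation, then their total weight exceeds that of `Fin q`. -/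
lemma sum_weight_lt_of_cover {q : ℕ} {d : Fin q → ℕ} (hd : ∀ k, 1 ≤ d k)
    {T : Fin q → Finset (Fin q)} (hT : Finset.univ.sup T = Finset.univ)
    (hne : ∀ j, (T j).Nonempty) (hperm : ∀ π : Equiv.Perm (Fin q), (fun j => {π j}) ≠ T) :
    ∑ k, d k < ∑ j, ∑ k ∈ T j, d k := by
  by_contra! hle
  -- Double counting: each index contributes its weight times the number of sets containing it, and
  -- covering makes that number at least 1.
  have hcount : ∑ j, ∑ k ∈ T j, d k = ∑ k, d k * (Finset.univ.filter fun j => k ∈ T j).card := by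
    rw [Finset.sum_comm' (t' := Finset.univ) (s' := fun k => Finset.univ.filter fun j => k ∈ T j)]
    · simp [mul_comm]
    · simp
  have hcover : ∀ k, 1 ≤ (Finset.univ.filter fun j => k ∈ T j).card := by
    intro k
    have hk : k ∈ Finset.univ.sup T := by rw [hT]; exact Finset.mem_univ k
    obtain ⟨j, -, hj⟩ := Finset.mem_sup.mp hk
    exact Finset.card_pos.mpr ⟨j, by simpa using hj⟩
  have hone : ∀ k, (Finset.univ.filter fun j => k ∈ T j).card = 1 := by
    have hterm : ∀ k ∈ Finset.univ, d k ≤ d k * (Finset.univ.filter fun j => k ∈ T j).card :=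
      fun k _ => Nat.le_mul_of_pos_right _ (hcover k)
    have heq := (Finset.sum_eq_sum_iff_of_le hterm).mp
      (le_antisymm (Finset.sum_le_sum hterm) (hcount ▸ hle))
    intro k
    exact Nat.eq_of_mul_eq_mul_left (hd k) (by rw [mul_one]; exact (heq k (Finset.mem_univ k)).symm)
  -- The sizes add up to `q`, so `q` nonempty sets must all be singletons. Covering then makes the
  -- chosen elements a permutation.
  have hcard : ∑ j, (T j).card = ∑ _j : Fin q, 1 := by
    have : ∑ j, (T j).card = ∑ k, (Finset.univ.filter fun j => k ∈ T j).card := by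
      simp only [Finset.card_eq_sum_ones]
      exact Finset.sum_comm' (by simp)
    rw [this]
    exact Finset.sum_congr rfl fun k _ => hone k
  have hsingle : ∀ j, (T j).card = 1 := fun j =>
    ((Finset.sum_eq_sum_iff_of_le fun j _ => Finset.card_pos.mpr (hne j)).mp hcard.symm j
      (Finset.mem_univ j)).symm
  choose f hf using fun j => Finset.card_eq_one.mp (hsingle j)
  have hsurj : Function.Surjective f := by
    intro k
    have hk : k ∈ Finset.univ.sup T := by rw [hT]; exact Finset.mem_univ k
    obtain ⟨j, -, hj⟩ := Finset.mem_sup.mp hk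
    rw [hf j, Finset.mem_singleton] at hj
    exact ⟨j, hj.symm⟩
  refine hperm (Equiv.ofBijective f (Finite.surjective_iff_bijective.mp hsurj)) ?_
  funext j
  exact (hf j).symm

/-- Multilinear expansion into ordered `q`-tuples of subsets of `S`. These are recorded as the
tuples with union inside `S`, ready to be sorted by their union. -/
lemma pow_sum_powerset {q : ℕ} (c : Finset (Fin q) → B) (S : Finset (Fin q)) :
    (∑ T ∈ S.powerset, c T) ^ q =
      ∑ T : Fin q → Finset (Fin q) with Finset.univ.sup T ⊆ S,
        (List.ofFn fun j => c (T j)).prod := by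
  have h := (MultilinearMap.mkPiAlgebraFin ℤ q B).map_sum_finset
    (fun _ T => c T) (fun _ => S.powerset)
  simp only [MultilinearMap.mkPiAlgebraFin_apply, List.ofFn_const, List.prod_replicate] at h
  rw [h]
  refine Finset.sum_congr ?_ fun _ _ => rfl
  ext T
  simp [Fintype.mem_piFinset, Finset.sup_le_iff]

/-- Vanishing of a function on the subsets of a finite set whose Möbius expansion is known. -/
lemma eq_zero_of_sum_powerset_eq_zero {ι : Type*} [DecidableEq ι] {P : Finset ι → B}
    (h : ∀ S : Finset ι, ∑ U ∈ S.powerset, P U = 0) (U : Finset ι) : P U = 0 := by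
  induction U using Finset.strongInduction with
  | H U ih =>
    have hU := h U
    rw [← Finset.sum_erase_add _ _ (Finset.mem_powerset_self U), Finset.sum_eq_zero, zero_add] at hU
    · exact hU
    · intro V hV
      rw [Finset.mem_erase, Finset.mem_powerset] at hV
      exact ih V (hV.2.ssubset_of_ne hV.1)

/-- Sorting the expanded power over `S` by the union of the tuple gives a sum of blocks indexed by
the subsets of `S`. As this sum is zero for every `S`, each block is zero. -/
lemma sum_cover_eq_zero {q : ℕ} {c : Finset (Fin q) → B}
    (hc : ∀ S : Finset (Fin q), (∑ T ∈ S.powerset, c T) ^ q = 0) (U : Finset (Fin q)) :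
    ∑ T : Fin q → Finset (Fin q) with Finset.univ.sup T = U,
      (List.ofFn fun j => c (T j)).prod = 0 := by
  refine eq_zero_of_sum_powerset_eq_zero
    (P := fun U => ∑ T : Fin q → Finset (Fin q) with Finset.univ.sup T = U,
      (List.ofFn fun j => c (T j)).prod) (fun S => ?_) U
  rw [← hc S, pow_sum_powerset, ← Finset.sum_fiberwise_of_maps_to
    (s := Finset.univ.filter fun T : Fin q → Finset (Fin q) => Finset.univ.sup T ⊆ S)
    (t := S.powerset) (g := fun T => Finset.univ.sup T) (by simp)]
  refine Finset.sum_congr rfl fun U hU => Finset.sum_congr ?_ fun _ _ => rfl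
  ext T
  simp only [Finset.mem_filter, Finset.mem_univ, true_and]
  constructor
  · rintro rfl; exact ⟨Finset.mem_powerset.mp hU, rfl⟩
  · exact fun h => h.2

lemma list_prod_mem_filtration {I : ℕ → AddSubgroup B} (hone : 1 ∈ I 0)
    (hmul : ∀ m n x y, x ∈ I m → y ∈ I n → x * y ∈ I (m + n)) {q : ℕ} {e : Fin q → ℕ}
    {x : Fin q → B} (hx : ∀ j, x j ∈ I (e j)) : (List.ofFn x).prod ∈ I (∑ j, e j) := by
  induction q with
  | zero => simpa using hone
  | succ q ih =>
    rw [List.ofFn_succ, List.prod_cons, Fin.sum_univ_succ]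
    exact hmul _ _ _ _ (hx 0) (ih fun j => hx j.succ)

/-- If every partial sum `∑ T ⊆ S, c T` has vanishing `q`-th power, where `c T` lies in the
filtration degree `∑ k ∈ T, d k`, then the linearization of the `q`-th power vanishes on the
linear coefficients `c {k}` modulo terms of higher filtration degree. -/
lemma sum_perm_prod_mem {I : ℕ → AddSubgroup B} (hanti : Antitone I) (hone : 1 ∈ I 0)
    (hmul : ∀ m n x y, x ∈ I m → y ∈ I n → x * y ∈ I (m + n)) {q : ℕ} {d : Fin q → ℕ}
    (hd : ∀ k, 1 ≤ d k) {c : Finset (Fin q) → B} (hc : ∀ T, c T ∈ I (∑ k ∈ T, d k))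
    (hc0 : c ∅ = 0) (hpow : ∀ S : Finset (Fin q), (∑ T ∈ S.powerset, c T) ^ q = 0) :
    ∑ π : Equiv.Perm (Fin q), (List.ofFn fun j => c {π j}).prod ∈ I (∑ k, d k + 1) := by
  classical
  have h0 := sum_cover_eq_zero hpow Finset.univ
  set s : Finset (Fin q → Finset (Fin q)) :=
    Finset.univ.filter fun T => Finset.univ.sup T = Finset.univ
  let emb : Equiv.Perm (Fin q) → Fin q → Finset (Fin q) := fun π j => {π j}
  have hemb : Function.Injective emb := fun π π' h =>
    Equiv.ext fun j => Finset.singleton_injective (congrFun h j)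
  have hsub : Finset.univ.image emb ⊆ s := by
    intro T hT
    obtain ⟨π, -, rfl⟩ := Finset.mem_image.mp hT
    rw [Finset.mem_filter]
    refine ⟨Finset.mem_univ _, Finset.eq_univ_iff_forall.mpr fun k => ?_⟩
    exact Finset.mem_sup.mpr ⟨π.symm k, Finset.mem_univ _, by simp [emb]⟩
  -- The permutation tuples are split off. A remaining tuple either has only nonempty members and
  -- excess weight, or contains ∅ and so has a zero factor.
  rw [← Finset.sum_sdiff hsub, Finset.sum_image hemb.injOn] at h0
  rw [eq_neg_of_add_eq_zero_right h0]
  refine neg_mem (sum_mem fun T hT => ?_)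
  rw [Finset.mem_sdiff, Finset.mem_filter] at hT
  by_cases hne : ∀ j, (T j).Nonempty
  · refine hanti (sum_weight_lt_of_cover hd hT.1.2 hne fun π h => hT.2 ?_)
      (list_prod_mem_filtration hone hmul fun j => hc (T j))
    exact Finset.mem_image.mpr ⟨π, Finset.mem_univ _, h⟩
  · push Not at hne
    obtain ⟨j, hj⟩ := hne
    rw [List.prod_eq_zero]
    · exact zero_mem _
    · rw [List.mem_ofFn]
      exact ⟨j, by rw [hj, hc0]⟩

end Linearization

variable (p : ℕ) {G : Type*} [Group G]

/-! ### The filtration of the group algebra and of its endomorphisms -/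

variable (G) in
/-- The filtration of the group algebra by the powers of the fundamental ideal, with the whole
algebra in degree `0`. -/
def omegaFil (n : ℕ) : Submodule (ZMod p) (MonoidAlgebra (ZMod p) G) :=
  -- The zeroth power of a submodule is only the line of scalars, so degree 0 needs its own value.
  if n = 0 then ⊤ else omega p G ^ n

lemma mem_omegaFil_zero (x : MonoidAlgebra (ZMod p) G) : x ∈ omegaFil p G 0 := by
  simp [omegaFil]

lemma omegaFil_pnat (i : ℕ+) : omegaFil p G i = omega p G ^ (i : ℕ) := if_neg i.ne_zero

lemma omegaFil_anti : Antitone (omegaFil p G) := by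
  refine antitone_nat_of_succ_le fun n => ?_
  rcases Nat.eq_zero_or_pos n with rfl | hn
  · exact fun x _ => mem_omegaFil_zero p x
  · lift n to ℕ+ using hn
    have h := omega_succ_le p (G := G) n
    rwa [← omegaFil_pnat, ← omegaFil_pnat] at h

lemma gel_mul_mem_omegaFil (n : ℕ) (g : G) {x : MonoidAlgebra (ZMod p) G}
    (hx : x ∈ omegaFil p G n) : gel p g * x ∈ omegaFil p G n := by
  rcases Nat.eq_zero_or_pos n with rfl | hn
  · exact mem_omegaFil_zero p _
  · lift n to ℕ+ using hn
    rw [omegaFil_pnat] at hx ⊢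
    exact gel_mul_mem p n g hx

lemma mul_gel_mem_omegaFil (n : ℕ) (g : G) {x : MonoidAlgebra (ZMod p) G}
    (hx : x ∈ omegaFil p G n) : x * gel p g ∈ omegaFil p G n := by
  rcases Nat.eq_zero_or_pos n with rfl | hn
  · exact mem_omegaFil_zero p _
  · lift n to ℕ+ using hn
    rw [omegaFil_pnat] at hx ⊢
    exact mul_gel_mem p n g hx

/-- When one degree is 0, this says that the filtration terms are two-sided ideals, which by
linearity is a statement about multiplication by group elements. -/
lemma mul_mem_omegaFil {m n : ℕ} {x y : MonoidAlgebra (ZMod p) G} (hx : x ∈ omegaFil p G m)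
    (hy : y ∈ omegaFil p G n) : x * y ∈ omegaFil p G (m + n) := by
  rcases Nat.eq_zero_or_pos m with rfl | hm
  · rw [zero_add]
    induction x using MonoidAlgebra.induction_on with
    | of g => exact gel_mul_mem_omegaFil p n g hy
    | add x x' h h' =>
      rw [add_mul]
      exact add_mem (h (mem_omegaFil_zero p _)) (h' (mem_omegaFil_zero p _))
    | smul r x h =>
      rw [smul_mul_assoc]
      exact Submodule.smul_mem _ _ (h (mem_omegaFil_zero p _))
  rcases Nat.eq_zero_or_pos n with rfl | hn
  · rw [add_zero]
    induction y using MonoidAlgebra.induction_on with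
    | of g => exact mul_gel_mem_omegaFil p m g hx
    | add x x' h h' =>
      rw [mul_add]
      exact add_mem (h (mem_omegaFil_zero p _)) (h' (mem_omegaFil_zero p _))
    | smul r x h =>
      rw [mul_smul_comm]
      exact Submodule.smul_mem _ _ (h (mem_omegaFil_zero p _))
  lift m to ℕ+ using hm
  lift n to ℕ+ using hn
  rw [← PNat.add_coe]
  rw [omegaFil_pnat] at *
  exact mul_mem_omega p hx hy

variable (G) in
/-- The endomorphisms of the group algebra that raise the filtration degree by at least `n`. -/
def endFil (n : ℕ) : AddSubgroup (Module.End (ZMod p) (MonoidAlgebra (ZMod p) G)) where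
  carrier := {f | ∀ m, ∀ x ∈ omegaFil p G m, f x ∈ omegaFil p G (n + m)}
  zero_mem' _ _ _ := zero_mem _
  add_mem' hf hg m x hx := add_mem (hf m x hx) (hg m x hx)
  neg_mem' hf m x hx := neg_mem (hf m x hx)

lemma endFil_anti : Antitone (endFil p G) := fun _ _ h _ hf m x hx =>
  omegaFil_anti p (Nat.add_le_add_right h m) (hf m x hx)

lemma one_mem_endFil : 1 ∈ endFil p G 0 := fun m x hx => by rwa [zero_add]

lemma mul_mem_endFil (m n : ℕ) (f g : Module.End (ZMod p) (MonoidAlgebra (ZMod p) G))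
    (hf : f ∈ endFil p G m) (hg : g ∈ endFil p G n) : f * g ∈ endFil p G (m + n) :=
  fun k x hx => by
    rw [add_assoc]
    exact hf _ _ (hg _ _ hx)

/-- The map `x ↦ (y ↦ x * y - y * x)` of an associative algebra. -/
def ringAd (R A : Type*) [CommRing R] [Ring A] [Algebra R A] : A →ₗ[R] Module.End R A :=
  LinearMap.mul R A - (LinearMap.mul R A).flip

lemma ringAd_apply {R A : Type*} [CommRing R] [Ring A] [Algebra R A] (x y : A) :
    ringAd R A x y = x * y - y * x := rfl

/-- In characteristic `p`, `ad (x) ^ (p ^ n) = ad (x ^ (p ^ n))`. -/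
lemma ringAd_pow_prime_pow {A : Type*} [Ring A] [Algebra (ZMod p) A] [Fact p.Prime] (x : A)
    (n : ℕ) : ringAd (ZMod p) A x ^ p ^ n = ringAd (ZMod p) A (x ^ p ^ n) := by
  rcases subsingleton_or_nontrivial A with _ | _
  · exact LinearMap.ext fun _ => Subsingleton.elim _ _
  have : Nontrivial (Module.End (ZMod p) A) := inferInstance
  have : CharP (Module.End (ZMod p) A) p :=
    charP_of_injective_algebraMap (algebraMap (ZMod p) (Module.End (ZMod p) A)).injective p
  have h : ∀ y : A, ringAd (ZMod p) A y
      = LinearMap.mulLeft (ZMod p) y - LinearMap.mulRight (ZMod p) y := fun _ => rfl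
  -- Left and right multiplication by `x` commute, so Frobenius applies to their difference.
  rw [h, h, sub_pow_char_pow_of_commute _ _ (LinearMap.commute_mulLeft_right x x),
    LinearMap.pow_mulLeft, LinearMap.pow_mulRight]

lemma ringAd_mem_endFil {n : ℕ} {x : MonoidAlgebra (ZMod p) G} (hx : x ∈ omegaFil p G n) :
    ringAd (ZMod p) _ x ∈ endFil p G n := fun m y hy => by
  rw [ringAd_apply]
  exact sub_mem (mul_mem_omegaFil p hx hy) (add_comm m n ▸ mul_mem_omegaFil p hy hx)

/-- Frobenius twice: once for ad, and once for (g - 1)^(p^n) = g^(p^n) - 1. -/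
lemma ringAd_gel_sub_one_pow [Fact p.Prime] {n : ℕ} {g : G} (hg : g ^ p ^ n = 1) :
    ringAd (ZMod p) (MonoidAlgebra (ZMod p) G) (gel p g - 1) ^ p ^ n = 0 := by
  have : CharP (MonoidAlgebra (ZMod p) G) p :=
    charP_of_injective_algebraMap (algebraMap (ZMod p) (MonoidAlgebra (ZMod p) G)).injective p
  rw [ringAd_pow_prime_pow, sub_pow_char_pow_of_commute _ _ (Commute.one_right _), ← map_pow, hg,
    map_one, one_pow, sub_self, map_zero]

/-! ### Filtered families of group elements -/

/-- A family of group elements indexed by the subsets `S` of `ι` is filtered with weights `d` if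
it is a sum over `T ⊆ S` of elements of the group algebra of filtration degree `∑ k ∈ T, d k`. -/
def IsFiltered {ι : Type*} (d : ι → ℕ) (x : Finset ι → G) : Prop :=
  ∃ c : Finset ι → MonoidAlgebra (ZMod p) G,
    (∀ T, c T ∈ omegaFil p G (∑ k ∈ T, d k)) ∧ ∀ S, gel p (x S) = ∑ T ∈ S.powerset, c T

section Filtered

variable {ι : Type*} [DecidableEq ι] {d : ι → ℕ}

lemma IsFiltered.one : IsFiltered p d (1 : Finset ι → G) := by
  refine ⟨fun T => if T = ∅ then 1 else 0, fun T => ?_, fun S => ?_⟩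
  · dsimp only
    split_ifs with h
    · subst h; exact mem_omegaFil_zero p _
    · exact zero_mem _
  · simp

/-- The product of the terms for T₁ and T₂ is assigned to T₁ ∪ T₂. Its degree is high enough because
the weight of a union is at most the sum of the weights. -/
lemma IsFiltered.mul [Fintype ι] {x y : Finset ι → G} (hx : IsFiltered p d x)
    (hy : IsFiltered p d y) : IsFiltered p d (x * y) := by
  obtain ⟨c, hc, hcx⟩ := hx
  obtain ⟨e, he, hey⟩ := hy
  refine ⟨fun U => ∑ t : Finset ι × Finset ι with t.1 ∪ t.2 = U, c t.1 * e t.2,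
    fun U => sum_mem fun t ht => ?_, fun S => ?_⟩
  · rw [Finset.mem_filter] at ht
    refine omegaFil_anti p ?_ (mul_mem_omegaFil p (hc t.1) (he t.2))
    rw [← ht.2, ← Finset.sum_union_inter]
    exact Nat.le_add_right _ _
  · rw [Pi.mul_apply, map_mul, hcx, hey, Finset.sum_mul_sum, ← Finset.sum_product',
      ← Finset.sum_fiberwise_of_maps_to (t := S.powerset) (g := fun t => t.1 ∪ t.2)]
    · refine Finset.sum_congr rfl fun U hU => Finset.sum_congr ?_ fun _ _ => rfl
      ext t
      simp only [Finset.mem_filter, Finset.mem_product, Finset.mem_powerset, Finset.mem_univ,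
        true_and] at hU ⊢
      constructor
      · exact fun h => h.2
      · rintro rfl
        exact ⟨⟨Finset.subset_union_left.trans hU, Finset.subset_union_right.trans hU⟩, rfl⟩
    · intro t ht
      rw [Finset.mem_product, Finset.mem_powerset, Finset.mem_powerset] at ht
      exact Finset.mem_powerset.mpr (Finset.union_subset ht.1 ht.2)

/-- Only two coefficients are nonzero: 1 at ∅ and g - 1 at {k}. -/
lemma IsFiltered.ite {k : ι} {g : G} (hg : gel p g - 1 ∈ omegaFil p G (d k)) :
    IsFiltered p d fun S => if k ∈ S then g else 1 := by
  refine ⟨fun T => if T = ∅ then 1 else if T = {k} then gel p g - 1 else 0, fun T => ?_,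
    fun S => ?_⟩
  · dsimp only
    split_ifs with h h'
    · subst h; exact mem_omegaFil_zero p _
    · subst h'; simpa using hg
    · exact zero_mem _
  · have h : ∀ T : Finset ι, (if T = ∅ then 1 else if T = {k} then gel p g - 1 else 0)
        = (if T = ∅ then (1 : MonoidAlgebra (ZMod p) G) else 0)
          + if T = {k} then gel p g - 1 else 0 := by
      intro T
      split_ifs with h h'
      · subst h; simp at h'
      · simp
      · simp
      · simp
    simp only [h, Finset.sum_add_distrib, Finset.sum_ite_eq', Finset.mem_powerset,
      Finset.empty_subset, if_true, Finset.singleton_subset_iff]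
    split_ifs <;> simp

/-- The families that are filtered together with their inverses form a group. -/
def filteredSubgroup [Fintype ι] (G : Type*) [Group G] (d : ι → ℕ) : Subgroup (Finset ι → G) where
  carrier := {x | IsFiltered p d x ∧ IsFiltered p d x⁻¹}
  one_mem' := ⟨IsFiltered.one p, by rw [inv_one]; exact IsFiltered.one p⟩
  mul_mem' hx hy := ⟨hx.1.mul p hy.1, by rw [mul_inv_rev]; exact hy.2.mul p hx.2⟩
  inv_mem' hx := ⟨hx.2, by rw [inv_inv]; exact hx.1⟩

end Filtered

lemma gel_sub_one_mem {i : ℕ+} {g : G} (hg : g ∈ zas p G i) : gel p g - 1 ∈ omegaFil p G i := by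
  rw [omegaFil_pnat, ← neg_sub]
  exact neg_mem hg

/-- The family of the products of the `g k`, `k ∈ S`. -/
def prodFamily {q : ℕ} (g : Fin q → G) (S : Finset (Fin q)) : G :=
  ((List.finRange q).map fun k => if k ∈ S then g k else 1).prod

/-- The family is a pointwise product of families switching one `g k` on or off. The inverse of such
a factor is of the same kind, with `(g k)⁻¹`. -/
lemma prodFamily_mem {q : ℕ} {g : Fin q → G} {d : Fin q → ℕ+} (hg : ∀ k, g k ∈ zas p G (d k)) :
    prodFamily g ∈ filteredSubgroup p G fun k => (d k : ℕ) := by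
  have h : prodFamily g =
      ((List.finRange q).map fun k (S : Finset (Fin q)) => if k ∈ S then g k else 1).prod := by
    funext S
    rw [Pi.list_prod_apply, List.map_map]
    rfl
  rw [h]
  refine list_prod_mem fun x hx => ?_
  obtain ⟨k, -, rfl⟩ := List.mem_map.mp hx
  refine ⟨IsFiltered.ite p (gel_sub_one_mem p (hg k)), ?_⟩
  convert IsFiltered.ite p (k := k) (d := fun k => (d k : ℕ))
    (gel_sub_one_mem p (inv_mem (hg k))) using 1
  funext S
  rw [Pi.inv_apply]
  split_ifs <;> simp

lemma prodFamily_singleton {q : ℕ} (g : Fin q → G) (k : Fin q) : prodFamily g {k} = g k := by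
  rw [prodFamily, List.prod_map_eq_pow_single k]
  · simp [List.count_eq_one_of_mem (List.nodup_finRange q) (List.mem_finRange k)]
  · intro j hj _
    simp [hj]

lemma map_prodFamily {q : ℕ} (φ : MulAut G) (g : Fin q → G) (S : Finset (Fin q)) :
    φ (prodFamily g S) = prodFamily (fun k => φ (g k)) S := by
  rw [prodFamily, prodFamily, map_list_prod, List.map_map]
  congr 2
  funext k
  simp only [Function.comp_apply]
  split_ifs <;> simp

/-- A filtered family with all values of exponent `p ^ n` satisfies a linearized identity. -/
lemma sum_perm_prod_ad_mem [Fact p.Prime] {n : ℕ} {d : Fin (p ^ n) → ℕ} (hd : ∀ k, 1 ≤ d k)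
    {v : Finset (Fin (p ^ n)) → G} (hv : IsFiltered p d v) (h0 : v ∅ = 1)
    (hpow : ∀ S, v S ^ p ^ n = 1) :
    ∑ π : Equiv.Perm (Fin (p ^ n)),
      (List.ofFn fun j => ringAd (ZMod p) (MonoidAlgebra (ZMod p) G)
        (gel p (v {π j}) - 1)).prod ∈ endFil p G (∑ k, d k + 1) := by
  obtain ⟨c, hc, hcv⟩ := hv
  have hc0 : c ∅ = 1 := by
    have h := hcv ∅
    rwa [h0, map_one, Finset.powerset_empty, Finset.sum_singleton, eq_comm] at h
  -- Removing the constant term 1 turns the expansion of `v S` into one of `v S - 1` with zero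
  -- coefficient at ∅, as the linearization requires.
  set e : Finset (Fin (p ^ n)) → MonoidAlgebra (ZMod p) G := fun T => if T = ∅ then 0 else c T
  have he : ∀ S, ∑ T ∈ S.powerset, e T = gel p (v S) - 1 := by
    intro S
    rw [hcv S, ← Finset.sum_erase_add _ _ (Finset.empty_mem_powerset S),
      ← Finset.sum_erase_add _ c (Finset.empty_mem_powerset S), hc0, add_sub_cancel_right]
    simp only [e, if_true, add_zero]
    exact Finset.sum_congr rfl fun T hT => if_neg (Finset.ne_of_mem_erase hT)
  have hes : ∀ k, e {k} = gel p (v {k}) - 1 := by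
    intro k
    rw [← he, show ({k} : Finset (Fin (p ^ n))).powerset = {∅, {k}} from rfl,
      Finset.sum_pair (Finset.singleton_ne_empty k).symm]
    simp [e]
  simp only [← hes]
  refine sum_perm_prod_mem (endFil_anti p) (one_mem_endFil p) (mul_mem_endFil p) hd
    (c := fun T => ringAd (ZMod p) _ (e T)) (fun T => ringAd_mem_endFil p ?_) (by simp [e])
    fun S => ?_
  · simp only [e]
    split_ifs
    · exact zero_mem _
    · exact hc T
  · simp only [← map_sum, he]
    rw [ringAd_gel_sub_one_pow p (hpow S)]

/-! ### Comparison of `L_p(G)` with the group algebra -/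

/-- `l` is homogeneous of degree `n ≥ 1` and is the class of some `x ∈ G_n` for which
`X ≡ x - 1` modulo `ω ^ (n + 1)`. -/
def IsSymbol (n : ℕ) (l : ZLie p G) (X : MonoidAlgebra (ZMod p) G) : Prop :=
  ∃ (i : ℕ+) (x : G) (hx : x ∈ zas p G i),
    (i : ℕ) = n ∧ l = cls p i x hx ∧ X - (gel p x - 1) ∈ omegaFil p G (n + 1)

lemma isSymbol_cls {i : ℕ+} {x : G} (hx : x ∈ zas p G i) :
    IsSymbol p i (cls p i x hx) (gel p x - 1) :=
  ⟨i, x, hx, rfl, rfl, by rw [sub_self]; exact zero_mem _⟩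

lemma isSymbol_zero {n : ℕ} (hn : 0 < n) : IsSymbol p n (0 : ZLie p G) 0 := by
  lift n to ℕ+ using hn
  have h := isSymbol_cls p (one_mem (zas p G n))
  rwa [cls_one, map_one, sub_self] at h

variable {p}

/-- xy - 1 = (x - 1) + (y - 1) + (x - 1)(y - 1), where the last term has degree 2n ≥ n + 1. -/
lemma IsSymbol.add {n : ℕ} {l l' : ZLie p G} {X Y : MonoidAlgebra (ZMod p) G}
    (h : IsSymbol p n l X) (h' : IsSymbol p n l' Y) : IsSymbol p n (l + l') (X + Y) := by
  obtain ⟨i, x, hx, rfl, rfl, hX⟩ := h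
  obtain ⟨j, y, hy, hij, rfl, hY⟩ := h'
  obtain rfl := PNat.coe_injective hij
  refine ⟨j, x * y, mul_mem hx hy, rfl, cls_add p hx hy, ?_⟩
  have hxy : (gel p x - 1) * (gel p y - 1) ∈ omegaFil p G (j + 1) :=
    omegaFil_anti p (Nat.add_le_add_left j.pos _)
      (mul_mem_omegaFil p (gel_sub_one_mem p hx) (gel_sub_one_mem p hy))
  convert sub_mem (add_mem hX hY) hxy using 1
  rw [map_mul]
  noncomm_ring

lemma IsSymbol.sum {ι : Type*} (s : Finset ι) {n : ℕ} (hn : 0 < n) {l : ι → ZLie p G}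
    {X : ι → MonoidAlgebra (ZMod p) G} (h : ∀ k ∈ s, IsSymbol p n (l k) (X k)) :
    IsSymbol p n (∑ k ∈ s, l k) (∑ k ∈ s, X k) := by
  classical
  induction s using Finset.induction_on with
  | empty => simpa using isSymbol_zero p hn
  | insert a s ha ih =>
    rw [Finset.sum_insert ha, Finset.sum_insert ha]
    exact (h a (Finset.mem_insert_self a s)).add
      (ih fun k hk => h k (Finset.mem_insert_of_mem hk))

/-- The leading term of [x, y] - 1 is the ring commutator of x - 1 and y - 1, and changing either
argument in higher degree only affects higher degree. -/
lemma IsSymbol.lie {m n : ℕ} {l l' : ZLie p G} {X Y : MonoidAlgebra (ZMod p) G}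
    (h : IsSymbol p m l X) (h' : IsSymbol p n l' Y) :
    IsSymbol p (m + n) (LieAlgebra.ad (ZMod p) (ZLie p G) l l') (ringAd (ZMod p) _ X Y) := by
  obtain ⟨i, x, hx, rfl, rfl, hX⟩ := h
  obtain ⟨j, y, hy, rfl, rfl, hY⟩ := h'
  refine ⟨i + j, comm x y, comm_mem p hx hy, PNat.add_coe i j, ?_, ?_⟩
  · rw [LieAlgebra.ad_apply, lie_cls]
  have hYj : Y ∈ omegaFil p G j := by
    rw [← sub_add_cancel Y (gel p y - 1)]
    exact add_mem (omegaFil_anti p (Nat.le_succ _) hY) (gel_sub_one_mem p hy)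
  have h1 : ringAd (ZMod p) _ (X - (gel p x - 1)) Y ∈ omegaFil p G (i + j + 1) := by
    rw [add_right_comm]
    exact ringAd_mem_endFil p hX _ _ hYj
  have h2 : ringAd (ZMod p) _ (gel p x - 1) (Y - (gel p y - 1)) ∈ omegaFil p G (i + j + 1) :=
    ringAd_mem_endFil p (gel_sub_one_mem p hx) _ _ hY
  have h3 := comm_congr p hx hy
  rw [← omegaFil_pnat, PNat.add_coe, PNat.add_coe, PNat.one_coe] at h3
  convert add_mem (add_mem h1 h2) h3 using 1
  simp only [ringAd_apply]
  noncomm_ring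

/-- The layer G_n/G_{n+1} embeds in ω^n/ω^(n+1) by x ↦ x - 1. This is how vanishing in the group
algebra descends to `L`. -/
lemma IsSymbol.eq_zero {n : ℕ} {l : ZLie p G} {X : MonoidAlgebra (ZMod p) G}
    (h : IsSymbol p n l X) (hX : X ∈ omegaFil p G (n + 1)) : l = 0 := by
  obtain ⟨i, x, hx, rfl, rfl, hXx⟩ := h
  rw [← cls_one p i]
  refine cls_eq p rfl hx (one_mem _) ?_
  rw [map_one, ← omegaFil_pnat, PNat.add_coe, PNat.one_coe]
  simpa using sub_mem hX hXx

lemma IsSymbol.list_prod {q : ℕ} {d : Fin q → ℕ} {l : Fin q → ZLie p G}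
    {X : Fin q → MonoidAlgebra (ZMod p) G} (h : ∀ k, IsSymbol p (d k) (l k) (X k)) {n : ℕ}
    {b : ZLie p G} {Y : MonoidAlgebra (ZMod p) G} (hb : IsSymbol p n b Y) :
    IsSymbol p (∑ k, d k + n)
      ((List.ofFn fun k => LieAlgebra.ad (ZMod p) (ZLie p G) (l k)).prod b)
      ((List.ofFn fun k => ringAd (ZMod p) _ (X k)).prod Y) := by
  induction q with
  | zero => simpa using hb
  | succ q ih =>
    rw [List.ofFn_succ, List.ofFn_succ, List.prod_cons, List.prod_cons, Fin.sum_univ_succ,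
      add_assoc]
    exact (h 0).lie (ih fun k => h k.succ)

/-- The adjoint operator of a homogeneous element given by an element of exponent `p ^ n`. -/
lemma ad_cls_pow_eq_zero [Fact p.Prime] {n : ℕ} {i : ℕ+} {v : G} (hv : v ∈ zas p G i)
    (hpow : v ^ p ^ n = 1) :
    LieAlgebra.ad (ZMod p) (ZLie p G) (cls p i v hv) ^ p ^ n = 0 := by
  refine LinearMap.ext fun b => ?_
  rw [LinearMap.zero_apply]
  induction b using cls_induction with
  | h0 => exact map_zero _
  | ha x y hx hy => rw [map_add, hx, hy, add_zero]
  | hc j y hy =>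
    have h := IsSymbol.list_prod (fun _ : Fin (p ^ n) => isSymbol_cls p hv) (isSymbol_cls p hy)
    simp only [List.ofFn_const, List.prod_replicate] at h
    refine h.eq_zero ?_
    rw [ringAd_gel_sub_one_pow p hpow]
    exact zero_mem _

/-! ### The elements `u * (u ^ rho) ^ 2` for `u = [x, sigma]` -/

/-- The element `u * (u ^ rho) ^ 2` for `u = [x, sigma]`. -/
def Triality.word (T : Triality G) (x : G) : G :=
  (x⁻¹ * T.sigma x) * T.rho (x⁻¹ * T.sigma x) ^ 2

/-- Replacing x by x^σ replaces u by u⁻¹. The two triality identities then express the inverse of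
u^(ρ²) both as u·u^ρ and as u^ρ·u. -/
lemma Triality.commute_rho (T : Triality G) (x : G) :
    Commute (x⁻¹ * T.sigma x) (T.rho (x⁻¹ * T.sigma x)) := by
  have h1 := T.triality x
  have h2 := T.triality (T.sigma x)
  have hs : T.sigma (T.sigma x) = x := by
    rw [← MulAut.mul_apply, ← pow_two, T.sigma_pow, MulAut.one_apply]
  have hu : (T.sigma x)⁻¹ * T.sigma (T.sigma x) = (x⁻¹ * T.sigma x)⁻¹ := by
    rw [hs, mul_inv_rev, inv_inv]
  rw [hu, map_inv, map_inv, ← mul_inv_rev, mul_inv_eq_one] at h2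
  rw [← h2] at h1
  rw [Commute, SemiconjBy, eq_inv_of_mul_eq_one_left h1, inv_inv]

lemma Triality.word_pow (T : Triality G) {m : ℕ} (hG : ∀ g : G, (g⁻¹ * T.sigma g) ^ m = 1)
    (x : G) : T.word x ^ m = 1 := by
  rw [Triality.word, ((T.commute_rho x).pow_right 2).mul_pow, hG, one_mul, ← pow_mul, mul_comm,
    pow_mul, ← map_pow, hG, map_one, one_pow]

lemma Triality.word_mem (T : Triality G) {i : ℕ+} {x : G} (hx : x ∈ zas p G i) :
    T.word x ∈ zas p G i := by
  have hu : x⁻¹ * T.sigma x ∈ zas p G i := mul_mem (inv_mem hx) (map_mem_zas p _ hx)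
  exact mul_mem hu (pow_mem (map_mem_zas p _ hu) 2)

/-- The map `a ↦ a + 2 a ^ rho` on `L_p(G)`. -/
def alphaMap (p : ℕ) (T : Triality G) : ZLie p G →ₗ[ZMod p] ZLie p G :=
  LinearMap.id + (2 : ZMod p) • (act p T.rho : ZLie p G →ₗ[ZMod p] ZLie p G)

lemma alphaMap_apply (T : Triality G) (a : ZLie p G) :
    alphaMap p T a = a + (2 : ZMod p) • act p T.rho a := rfl

/-- The map `x ↦ alpha (x ^ sigma - x)` on `L_p(G)`, induced by `Triality.word`. -/
def wordMap (p : ℕ) (T : Triality G) : ZLie p G →ₗ[ZMod p] ZLie p G :=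
  alphaMap p T ∘ₗ ((act p T.sigma : ZLie p G →ₗ[ZMod p] ZLie p G) - LinearMap.id)

lemma wordMap_apply (T : Triality G) (x : ZLie p G) :
    wordMap p T x = alphaMap p T (act p T.sigma x - x) := rfl

/-- Addition in a layer is multiplication in `G`, so the class of u(u^ρ)^2 is the class of u plus
twice that of u^ρ. -/
lemma wordMap_cls (T : Triality G) {i : ℕ+} {x : G} (hx : x ∈ zas p G i) :
    wordMap p T (cls p i x hx) = cls p i (T.word x) (T.word_mem hx) := by
  have hu : x⁻¹ * T.sigma x ∈ zas p G i := mul_mem (inv_mem hx) (map_mem_zas p _ hx)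
  have e : act p T.sigma (cls p i x hx) - cls p i x hx = cls p i (x⁻¹ * T.sigma x) hu := by
    rw [sub_eq_iff_eq_add', act_cls, cls_add]
    exact cls_eq p rfl _ _ (by simp)
  rw [wordMap_apply, e, alphaMap_apply, act_cls, two_smul, cls_add, cls_add]
  exact cls_eq p rfl _ _ (by simp [Triality.word, pow_two])

/-! ### The linearized identity -/

/-- The linearized identity is applied to the word evaluated at all subset products of the `g k`.
Its leading term is then read off in `L`. -/
lemma sum_perm_prod_ad_cls [Fact p.Prime] (T : Triality G) {n : ℕ}
    (hG : ∀ g : G, (g⁻¹ * T.sigma g) ^ p ^ n = 1) {d : Fin (p ^ n) → ℕ+} {g : Fin (p ^ n) → G}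
    (hg : ∀ k, g k ∈ zas p G (d k)) :
    ∑ π : Equiv.Perm (Fin (p ^ n)), (List.ofFn fun j =>
      LieAlgebra.ad (ZMod p) (ZLie p G) (wordMap p T (cls p (d (π j)) (g (π j)) (hg (π j))))).prod
        = 0 := by
  -- The word is built from subset products of the `g k` and of their images under automorphisms,
  -- which stay in the same `zas` terms. It involves inverses, hence the subgroup of filtered
  -- families.
  have hfam : (fun S => T.word (prodFamily g S)) ∈ filteredSubgroup p G fun k => (d k : ℕ) := by
    have h1 := prodFamily_mem p hg
    have h2 := prodFamily_mem p fun k => map_mem_zas p T.sigma (hg k)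
    have h3 := prodFamily_mem p fun k => map_mem_zas p T.rho (hg k)
    have h4 := prodFamily_mem p fun k => map_mem_zas p T.rho (map_mem_zas p T.sigma (hg k))
    convert mul_mem (mul_mem (inv_mem h1) h2) (pow_mem (mul_mem (inv_mem h3) h4) 2) using 1
    funext S
    simp only [Triality.word, map_mul, map_inv, map_prodFamily, Pi.mul_apply, Pi.inv_apply,
      Pi.pow_apply]
  have key := sum_perm_prod_ad_mem p (fun k => (d k).pos) hfam.1
    (by simp [prodFamily, Triality.word]) fun S => T.word_pow hG _
  simp only [prodFamily_singleton] at key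
  refine LinearMap.ext fun b => ?_
  rw [LinearMap.zero_apply]
  induction b using cls_induction with
  | h0 => exact map_zero _
  | ha x y hx hy => rw [map_add, hx, hy, add_zero]
  | hc j y hy =>
    simp only [wordMap_cls, LinearMap.sum_apply]
    have hsym : ∀ π ∈ (Finset.univ : Finset (Equiv.Perm (Fin (p ^ n)))),
        IsSymbol p (∑ k, (d k : ℕ) + j)
          ((List.ofFn fun k => LieAlgebra.ad (ZMod p) (ZLie p G)
            (cls p (d (π k)) (T.word (g (π k))) (T.word_mem (hg (π k))))).prod (cls p j y hy))
          ((List.ofFn fun k => ringAd (ZMod p) _ (gel p (T.word (g (π k))) - 1)).prod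
            (gel p y - 1)) := fun π _ => by
      -- Reindexing puts the symbols of all permutations in one common degree, so that they can be
      -- added.
      rw [← Equiv.sum_comp π fun k => (d k : ℕ)]
      exact IsSymbol.list_prod (fun k => isSymbol_cls p (T.word_mem (hg (π k))))
        (isSymbol_cls p hy)
    refine (IsSymbol.sum _ (Nat.add_pos_right _ j.pos) hsym).eq_zero ?_
    have h := key j _ (gel_sub_one_mem p hy)
    rwa [LinearMap.sum_apply, add_right_comm] at h

lemma span_cls : Submodule.span (ZMod p)
    (Set.range fun t : Σ i : ℕ+, zas p G i => cls p t.1 (t.2 : G) t.2.2) = ⊤ := by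
  rw [eq_top_iff]
  rintro x -
  induction x using cls_induction with
  | h0 => exact zero_mem _
  | ha x y hx hy => exact add_mem hx hy
  | hc i x hx => exact Submodule.subset_span ⟨⟨i, x, hx⟩, rfl⟩

/-- The sum is multilinear in `x` and the homogeneous classes span `L`, so mixed degrees need no
separate argument. -/
lemma sum_perm_prod_ad_wordMap [Fact p.Prime] (T : Triality G) {n : ℕ}
    (hG : ∀ g : G, (g⁻¹ * T.sigma g) ^ p ^ n = 1) (x : Fin (p ^ n) → ZLie p G) :
    ∑ π : Equiv.Perm (Fin (p ^ n)), (List.ofFn fun j =>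
      LieAlgebra.ad (ZMod p) (ZLie p G) (wordMap p T (x (π j)))).prod = 0 := by
  let ψ : ZLie p G →ₗ[ZMod p] Module.End (ZMod p) (ZLie p G) :=
    (LieAlgebra.ad (ZMod p) (ZLie p G) : ZLie p G →ₗ[ZMod p] _) ∘ₗ wordMap p T
  let Ψ : MultilinearMap (ZMod p) (fun _ : Fin (p ^ n) => ZLie p G)
      (Module.End (ZMod p) (ZLie p G)) :=
    ∑ π : Equiv.Perm (Fin (p ^ n)),
      ((MultilinearMap.mkPiAlgebraFin (ZMod p) (p ^ n)
        (Module.End (ZMod p) (ZLie p G))).compLinearMap fun _ => ψ).domDomCongr π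
  have hΨ : ∀ x, Ψ x = ∑ π : Equiv.Perm (Fin (p ^ n)), (List.ofFn fun j =>
      LieAlgebra.ad (ZMod p) (ZLie p G) (wordMap p T (x (π j)))).prod := fun x => by
    simp only [Ψ, sum_apply, MultilinearMap.domDomCongr_apply,
      MultilinearMap.compLinearMap_apply, MultilinearMap.mkPiAlgebraFin_apply]
    rfl
  have h0 : Ψ = 0 := by
    refine MultilinearMap.ext_of_span_eq_top
      (g := fun _ (t : Σ i : ℕ+, zas p G i) => cls p t.1 (t.2 : G) t.2.2) (fun _ => span_cls) fun t => ?_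
    rw [hΨ, zero_apply]
    exact sum_perm_prod_ad_cls T hG fun k => (t k).2.2
  rw [← hΨ, h0, zero_apply]

/-! ### The operators `ad*` -/

/-- Each ad*(a) is ad(a + 2a^ρ) restricted to `H`, so operator identities on `L` restrict to `H`. -/
lemma coe_list_prod_adStar (T : Triality G) [Fact p.Prime] (hp : 3 < p) (s : List (malcev p T))
    (h : malcev p T) : ((s.map (adStar p T hp)).prod h : ZLie p G) =
      (s.map fun a : malcev p T =>
        LieAlgebra.ad (ZMod p) (ZLie p G) (alphaMap p T a)).prod (h : ZLie p G) := by
  induction s with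
  | nil => rfl
  | cons a s ih =>
    rw [List.map_cons, List.map_cons, List.prod_cons, List.prod_cons, Module.End.mul_apply,
      Module.End.mul_apply, ← ih]
    rfl

lemma two_ne_zero_of_three_lt [Fact p.Prime] (hp : 3 < p) : (2 : ZMod p) ≠ 0 := by
  have : Fact (2 < p) := ⟨by omega⟩
  exact Ring.two_ne_zero (by rw [ZMod.ringChar_zmod_n]; omega)

/-- On `H` the map σ - 1 is multiplication by -2, so -a/2 is a preimage of a. -/
lemma alphaMap_eq_wordMap (T : Triality G) [Fact p.Prime] (hp : 3 < p) {a : ZLie p G}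
    (ha : a ∈ malcev p T) : alphaMap p T a = wordMap p T ((-2⁻¹ : ZMod p) • a) := by
  rw [wordMap_apply, map_smul, show act p T.sigma a = -a from ha, smul_neg, neg_smul, neg_neg,
    sub_neg_eq_add, ← add_smul, ← two_mul, mul_inv_cancel₀ (two_ne_zero_of_three_lt hp), one_smul]

end TrialityLie

end

theorem lemma4p6 {G : Type*} [Group G] (T : TrialityLie.Triality G) (p n : ℕ) [Fact p.Prime]
    (hp : 3 < p) (hG : ∀ g : G, (g⁻¹ * T.sigma g) ^ (p ^ n) = 1) :
    (∀ i : ℕ+, ∀ a ∈ TrialityLie.malcevComponent p T i,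
      TrialityLie.adStar p T hp a ^ (p ^ n) = 0) ∧
    (∀ a : Fin (p ^ n) → TrialityLie.malcev p T,
      ∑ π : Equiv.Perm (Fin (p ^ n)),
        (List.ofFn fun k => TrialityLie.adStar p T hp (a (π k))).prod = 0) := by
  refine ⟨fun i a ha => ?_, fun a => ?_⟩
  · obtain ⟨l, hl⟩ := ha
    -- Homogeneity enters here: -a/2 is the class of a single group element, whose word has exponent
    -- `p ^ n`.
    obtain ⟨x, hx⟩ := TrialityLie.Layer.mk_surjective p i ((-2⁻¹ : ZMod p) • l)
    have hcls : (-2⁻¹ : ZMod p) • (a : TrialityLie.ZLie p G) = TrialityLie.cls p i (x : G) x.2 := by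
      rw [TrialityLie.cls, Subtype.coe_eta, hx, ← DirectSum.lof_eq_of (ZMod p), map_smul, hl]
      rfl
    have had : LieAlgebra.ad (ZMod p) (TrialityLie.ZLie p G)
        (TrialityLie.alphaMap p T a) ^ p ^ n = 0 := by
      rw [TrialityLie.alphaMap_eq_wordMap T hp a.2, hcls, TrialityLie.wordMap_cls]
      exact TrialityLie.ad_cls_pow_eq_zero _ (T.word_pow hG _)
    refine LinearMap.ext fun h => Subtype.ext ?_
    have hcoe := TrialityLie.coe_list_prod_adStar T hp (List.replicate (p ^ n) a) h
    rw [List.map_replicate, List.map_replicate, List.prod_replicate, List.prod_replicate,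
      had] at hcoe
    exact hcoe
  · refine LinearMap.ext fun h => Subtype.ext ?_
    have hsum := TrialityLie.sum_perm_prod_ad_wordMap T hG
      fun k => (-2⁻¹ : ZMod p) • (a k : TrialityLie.ZLie p G)
    simp only [← TrialityLie.alphaMap_eq_wordMap T hp (a _).2] at hsum
    have hcoe : ∀ π : Equiv.Perm (Fin (p ^ n)), _ := fun π =>
      TrialityLie.coe_list_prod_adStar T hp (List.ofFn fun k => a (π k)) h
    simp only [List.map_ofFn] at hcoe
    rw [LinearMap.sum_apply, Submodule.coe_sum]
    refine (Finset.sum_congr rfl fun π _ => hcoe π).trans ?_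
    exact (LinearMap.sum_apply _ _ _).symm.trans (congrArg (fun f => f (h : _)) hsum)
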